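/- Let $D\subset\mathbb R^2$ be a bounded, strictly convex domain (non-empty, open, bounded, convex, with no line segment in its boundary; such a $D$ is simply connected and Lipschitz). Let $a,q>0$ be constants and $n=\sqrt{q/a}$, and assume $n>1$ and $na>1$ (so that $(a,q)\ne(1,1)$). Let $A=a$, $Q=q$ in $D$ and $A=Q=1$ outside $D$. For $k>0$ and a unit vector $\eta\in\mathbb R^2$ consider the incident plane wave $u^{\rm in}(x)=e^{ik\eta\cdot x}$. A total field is a function $u\in H^1_{\rm loc}(\mathbb R^2)$ that solves $\nabla\cdot(A\nabla u)+k^2Qu=0$ weakly in $\mathbb R^2$ and whose scattered part $u^{\rm sc}=u-u^{\rm in}$ satisfies the Sommerfeld radiation condition. The wave $u^{\rm in}$ is called non-scattering if there is a total field with $u^{\rm sc}=0$ outside $D$ (equivalently, if some $u^{\rm tr}\in H^1(D)$ satisfies $a\Delta u^{\rm tr}+k^2qu^{\rm tr}=0$ in $D$ and $u^{\rm tr}=u^{\rm in}$, $a\,\partial_\nu u^{\rm tr}=\partial_\nu u^{\rm in}$ on $\partial D$ in the weak sense), and it is said to be scattered by $D$ otherwise. For a unit vector $\lambda$ let $w(\lambda)=\sup_{x\in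 D}\lambda\cdot x-\inf_{x\in D}\lambda\cdot x$ be the width of $D$ in the direction $\lambda$, and let $w^*$ and $w_*$ be the maximum and the minimum of $w$ over all unit vectors. (i) If $D$ has constant width (that is, $w(\lambda)$ does not depend on $\lambda$) and $n\le 3$, then for every $k>0$ and every unit vector $\eta$ the plane wave $e^{ik\eta\cdot x}$ is scattered by $D$. (ii) If $w^*\ge 2w_*$, then for every $k>0$ and every unit vector $\eta$ the plane wave $e^{ik\eta\cdot x}$ is scattered by $D$. -/

import Mathlib

open Set MeasureTheory Filter Topology
open scoped ContDiff

/-- The plane with its Euclidean norm, inner product and Lebesgue measure. -/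
abbrev Plane : Type := EuclideanSpace ℝ (Fin 2)

/-- The partial derivative of a complex-valued function on the plane in the `i`-th coordinate. -/
noncomputable def partialDeriv (i : Fin 2) (φ : Plane → ℂ) (x : Plane) : ℂ :=
  fderiv ℝ φ x (EuclideanSpace.single i 1)

/-- Complex-valued test functions: smooth with compact support. -/
def IsTestFunction (φ : Plane → ℂ) : Prop :=
  ContDiff ℝ ∞ φ ∧ HasCompactSupport φ

/-- `f` is locally square integrable on the plane. -/
def IsLocallyL2 (f : Plane → ℂ) : Prop :=
  ∀ K : Set Plane, IsCompact K → MemLp f 2 (volume.restrict K)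

/-- `u` belongs to `H¹_loc(ℝ²)` and `g` is its weak gradient. -/
structure HasWeakGradient (u : Plane → ℂ) (g : Fin 2 → Plane → ℂ) : Prop where
  locallyL2 : IsLocallyL2 u
  gradient_locallyL2 : ∀ i, IsLocallyL2 (g i)
  integral_eq : ∀ i, ∀ φ : Plane → ℂ, IsTestFunction φ →
    ∫ x, u x * partialDeriv i φ x = -∫ x, g i x * φ x

open Classical in
/-- The material coefficient equal to `c` in the inhomogeneity `D` and to `1` outside. -/
noncomputable def coefficient (D : Set Plane) (c : ℝ) (x : Plane) : ℝ :=
  if x ∈ D then c else 1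

/-- `u ∈ H¹_loc(ℝ²)` is a weak solution of `∇ · (A ∇u) + k² Q u = 0` in `ℝ²`, where
`(A, Q) = (a, q)` in `D` and `(A, Q) = (1, 1)` outside `D`.
The continuity of `u` and of its conormal derivative across `∂D` is part of the weak equation. -/
def IsWeakHelmholtzSolution (D : Set Plane) (a q k : ℝ) (u : Plane → ℂ) : Prop :=
  ∃ g : Fin 2 → Plane → ℂ, HasWeakGradient u g ∧
    ∀ φ : Plane → ℂ, IsTestFunction φ →
      ∫ x, ((coefficient D a x : ℂ) * ∑ i, g i x * partialDeriv i φ x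
        - (k : ℂ) ^ 2 * (coefficient D q x : ℂ) * u x * φ x) = 0

/-- The Sommerfeld radiation condition `√r (∂_r v - i k v) → 0` as `r = |x| → ∞`, uniformly in the
direction, for a function on the exterior of `D`. A field defined up to null sets satisfies it if
its smooth representative in the exterior of `D` does. -/
def IsRadiating (D : Set Plane) (k : ℝ) (usc : Plane → ℂ) : Prop :=
  ∃ v : Plane → ℂ, ContDiffOn ℝ ∞ v (closure D)ᶜ ∧
    usc =ᵐ[volume.restrict (closure D)ᶜ] v ∧
    Tendsto (fun x : Plane =>
        (Real.sqrt ‖x‖ : ℂ) * (fderiv ℝ v x (‖x‖⁻¹ • x) - Complex.I * (k : ℂ) * v x))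
      (Bornology.cobounded Plane) (𝓝 0)

/-- `u` is a total field (equal to the transmitted wave in `D`, and to the sum of the incident and
the scattered wave outside `D`) for the incident wave `uin` at wave number `k`, with the
inhomogeneity `D` of material parameters `(a, q)` in the background medium `(1, 1)`. -/
structure IsTotalField (D : Set Plane) (a q k : ℝ) (uin u : Plane → ℂ) : Prop where
  helmholtz : IsWeakHelmholtzSolution D a q k u
  radiating : IsRadiating D k (fun x => u x - uin x)

/-- The incident wave `uin` is non-scattering: the scattered wave `u - uin` of a total field `u`
vanishes outside `D`. -/
def IsNonScattering (D : Set Plane) (a q k : ℝ) (uin : Plane → ℂ) : Prop :=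
  ∃ u : Plane → ℂ, IsTotalField D a q k uin u ∧
    (fun x => u x - uin x) =ᵐ[volume.restrict (closure D)ᶜ] fun _ => 0

/-- The incident wave `uin` is scattered by the inhomogeneity `D`. -/
def IsScattered (D : Set Plane) (a q k : ℝ) (uin : Plane → ℂ) : Prop :=
  ¬ IsNonScattering D a q k uin

/-- The plane wave `exp (i k η · x)`. -/
noncomputable def planeWave (k : ℝ) (η : Plane) (x : Plane) : ℂ :=
  Complex.exp (Complex.I * ((k * inner ℝ η x : ℝ) : ℂ))

/-- The refractive index `n = √(q / a)`. -/
noncomputable def refractiveIndex (a q : ℝ) : ℝ := Real.sqrt (q / a)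

/-- A bounded strictly convex domain: non-empty, open, bounded, convex, and with no line segment
in its boundary (for an open convex set, `StrictConvex` of the closure says exactly the latter).
Such a set is automatically simply connected with Lipschitz boundary. -/
structure IsStrictlyConvexDomain (D : Set Plane) : Prop where
  isOpen : IsOpen D
  nonempty : D.Nonempty
  isBounded : Bornology.IsBounded D
  convex : Convex ℝ D
  strictConvex : StrictConvex ℝ (closure D)

/-- The width of `D` in the direction `l`. -/
noncomputable def width (D : Set Plane) (l : Plane) : ℝ :=
  sSup ((fun x => inner ℝ l x) '' D) - sInf ((fun x => inner ℝ l x) '' D)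

/-- The maximal width of `D`. -/
noncomputable def maxWidth (D : Set Plane) : ℝ := sSup (width D '' Metric.sphere 0 1)

/-- The minimal width of `D`. -/
noncomputable def minWidth (D : Set Plane) : ℝ := sInf (width D '' Metric.sphere 0 1)

/-- `D` has constant width. -/
def HasConstantWidth (D : Set Plane) : Prop :=
  ∃ c : ℝ, ∀ l : Plane, ‖l‖ = 1 → width D l = c

/-! ### Integrability and test functions -/

/-! Suppose `planeWave k η` is non-scattering. Then the total field minus the incident wave vanishes
a.e. off `D`. Testing the transmission problem against a plane wave of the interior medium, with
wave number `k * n` and direction `ξ`, yields an explicit factor times the integral over `D` of `exp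
(i (k η + k n ξ) · x)`, and this product is zero (`IsNonScattering.mul_integral_eq_zero`). The
conditions `n > 1` and `n a > 1` keep the factor away from zero, so the Fourier transform of the
indicator of `D` vanishes on the whole circle with centre `k η` and radius `k n`. Since `n > 1`,
this circle surrounds the origin and meets each ray `ℝ₊ l` once, at distance `t(l) = circleRadius k
n η l`.

Along the line `ℝ l` that transform is the one-dimensional transform of the section length of `D`,
which is positive and strictly concave on an interval of length `width D l`. Strict concavity
forbids a zero at `t * width = 2π m` with `m ≥ 1` (the cosine coefficient is negative), and also
below `2π` (the cosine coefficient about the midpoint is positive). So `t(l) * width D l` is at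
least `2π` and avoids all positive multiples of `2π`; being continuous on the connected unit circle,
it stays strictly between `2π m` and `2π (m + 1)` for a single `m ≥ 1`. Any two of its values
therefore have ratio less than `(m + 1) / m ≤ 2`.

For constant width, comparing `l = η` with `l = -η` gives `(n + 1) / (n - 1) < 2`, that is `n > 3`.
In general `t(l) t(-l) = k² (n² - 1)` does not depend on `l`, so multiplying the bounds at `l` and
`-l` leaves only the widths and gives `w* < 2 w_*`. -/

theorem IsLocallyL2.locallyIntegrable {f : Plane → ℂ} (hf : IsLocallyL2 f) :
    LocallyIntegrable f := by
  rw [MeasureTheory.locallyIntegrable_iff]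
  intro K hK
  have : IsFiniteMeasure (volume.restrict K) := ⟨by
    simpa using hK.measure_lt_top⟩
  exact (hf K hK).integrable (by norm_num)

theorem MeasureTheory.LocallyIntegrable.integrable_mul_of_hasCompactSupport
    {f φ : Plane → ℂ} (hf : LocallyIntegrable f) (hφ : Continuous φ) (hc : HasCompactSupport φ) :
    Integrable fun x => f x * φ x := by
  have := hf.integrable_smul_left_of_hasCompactSupport hφ hc
  refine this.congr (.of_forall fun x => ?_)
  simp [mul_comm]

theorem partialDeriv_contDiff {φ : Plane → ℂ} (hφ : ContDiff ℝ ∞ φ) (i : Fin 2) :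
    ContDiff ℝ ∞ (partialDeriv i φ) := by
  unfold partialDeriv
  exact (hφ.fderiv_right (m := ∞) (by simp)).clm_apply contDiff_const

theorem IsTestFunction.partialDeriv {φ : Plane → ℂ} (hφ : IsTestFunction φ) (i : Fin 2) :
    IsTestFunction (partialDeriv i φ) :=
  ⟨partialDeriv_contDiff hφ.1 i, hφ.2.fderiv_apply ℝ _⟩

theorem partialDeriv_eq_zero_of_notMem_tsupport {φ : Plane → ℂ} {i : Fin 2} {x : Plane}
    (hx : x ∉ tsupport φ) : partialDeriv i φ x = 0 := by
  have : fderiv ℝ φ x = 0 := by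
    by_contra h
    exact hx (support_fderiv_subset ℝ h)
  simp [partialDeriv, this]

theorem partialDeriv_congr {φ ψ : Plane → ℂ} {i : Fin 2} {x : Plane} (h : φ =ᶠ[𝓝 x] ψ) :
    partialDeriv i φ x = partialDeriv i ψ x := by
  simp [partialDeriv, h.fderiv_eq]

theorem partialDeriv_partialDeriv_congr {φ ψ : Plane → ℂ} {i j : Fin 2} {x : Plane}
    (h : φ =ᶠ[𝓝 x] ψ) :
    partialDeriv i (partialDeriv j φ) x = partialDeriv i (partialDeriv j ψ) x :=
  partialDeriv_congr (h.eventuallyEq_nhds.mono fun _ hy => partialDeriv_congr hy)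

/-- Integration by parts against a test function. -/
theorem integral_mul_partialDeriv {f φ : Plane → ℂ} (hf : ContDiff ℝ ∞ f)
    (hφ : IsTestFunction φ) (i : Fin 2) :
    ∫ x, f x * partialDeriv i φ x = -∫ x, partialDeriv i f x * φ x := by
  have h1 : ContDiff ℝ ∞ (partialDeriv i f) := partialDeriv_contDiff hf i
  have h2 := hφ.partialDeriv i
  exact integral_mul_fderiv_eq_neg_fderiv_mul_of_integrable
    (h1.continuous.locallyIntegrable.integrable_mul_of_hasCompactSupport hφ.1.continuous hφ.2)
    (hf.continuous.locallyIntegrable.integrable_mul_of_hasCompactSupport h2.1.continuous h2.2)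
    (hf.continuous.locallyIntegrable.integrable_mul_of_hasCompactSupport hφ.1.continuous hφ.2)
    (fun x _ => (hf.differentiable (by simp)).differentiableAt)
    (fun x _ => (hφ.1.differentiable (by simp)).differentiableAt)

theorem HasWeakGradient.sub_contDiff {u f : Plane → ℂ} {g : Fin 2 → Plane → ℂ}
    (h : HasWeakGradient u g) (hf : ContDiff ℝ ∞ f) {φ : Plane → ℂ} (hφ : IsTestFunction φ)
    (i : Fin 2) :
    ∫ x, (u x - f x) * partialDeriv i φ x = -∫ x, (g i x - partialDeriv i f x) * φ x := by
  have h1 := (partialDeriv_contDiff hf i).continuous.locallyIntegrable (μ := volume)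
    |>.integrable_mul_of_hasCompactSupport hφ.1.continuous hφ.2
  have hp := hφ.partialDeriv i
  have h2 := hf.continuous.locallyIntegrable (μ := volume)
    |>.integrable_mul_of_hasCompactSupport hp.1.continuous hp.2
  have h3 := h.locallyL2.locallyIntegrable.integrable_mul_of_hasCompactSupport
    hp.1.continuous hp.2
  have h4 := (h.gradient_locallyL2 i).locallyIntegrable.integrable_mul_of_hasCompactSupport
    hφ.1.continuous hφ.2
  simp only [sub_mul]
  rw [integral_sub h3 h2, integral_sub h4 h1, h.integral_eq i φ hφ,
    integral_mul_partialDeriv hf hφ]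
  ring

/-- A weak gradient vanishes where the function vanishes. -/
theorem HasWeakGradient.ae_eq_of_ae_eq {u f : Plane → ℂ} {g : Fin 2 → Plane → ℂ}
    (h : HasWeakGradient u g) (hf : ContDiff ℝ ∞ f) {U : Set Plane} (hU : IsOpen U)
    (huf : ∀ᵐ x, x ∈ U → u x = f x) (i : Fin 2) :
    ∀ᵐ x, x ∈ U → g i x = partialDeriv i f x := by
  have key : ∀ᵐ x, x ∈ U → g i x - partialDeriv i f x = 0 := by
    refine hU.ae_eq_zero_of_integral_contDiff_smul_eq_zero ?_ ?_
    · exact ((h.gradient_locallyL2 i).locallyIntegrable.sub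
        (partialDeriv_contDiff hf i).continuous.locallyIntegrable).locallyIntegrableOn U
    · intro ψ hψ hc hs
      set φ : Plane → ℂ := fun x => (ψ x : ℂ) with hφdef
      have hφ : IsTestFunction φ :=
        ⟨Complex.ofRealCLM.contDiff.comp hψ, hc.comp_left (g := Complex.ofReal) rfl⟩
      have hsupp : tsupport φ ⊆ tsupport ψ := by
        refine closure_mono fun x hx => ?_
        simp only [hφdef, Function.mem_support] at hx ⊢
        exact fun h => hx (by simp [h])
      have h0 := h.sub_contDiff hf hφ i
      have h1 : ∫ x, (u x - f x) * partialDeriv i φ x = 0 := by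
        refine integral_eq_zero_of_ae ?_
        filter_upwards [huf] with x hx
        by_cases hxU : x ∈ U
        · simp [hx hxU]
        · simp [partialDeriv_eq_zero_of_notMem_tsupport (fun h => hxU (hs (hsupp h)))]
      rw [h1, eq_comm, neg_eq_zero] at h0
      rw [← h0]
      refine integral_congr_ae (.of_forall fun x => ?_)
      simp [hφdef, mul_comm]
  filter_upwards [key] with x hx hxU using sub_eq_zero.1 (hx hxU)

/-! ### Plane waves -/

theorem planeWave_contDiff (k : ℝ) (η : Plane) : ContDiff ℝ ∞ (planeWave k η) := by
  unfold planeWave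
  have : ContDiff ℝ ∞ fun x : Plane => k * inner ℝ η x :=
    contDiff_const.mul (innerSL ℝ η).contDiff
  exact (contDiff_const.mul (Complex.ofRealCLM.contDiff.comp this)).cexp

theorem partialDeriv_planeWave (k : ℝ) (η : Plane) (i : Fin 2) (x : Plane) :
    partialDeriv i (planeWave k η) x = Complex.I * (k * η i : ℝ) * planeWave k η x := by
  have h1 : HasFDerivAt (fun x : Plane => k * inner ℝ η x) (k • innerSL ℝ η) x :=
    ((innerSL ℝ η).hasFDerivAt).const_mul k
  have h2 := ((Complex.ofRealCLM.hasFDerivAt.comp x h1).const_mul Complex.I).cexp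
  have h3 : HasFDerivAt (planeWave k η) _ x := h2
  rw [partialDeriv, h3.fderiv]
  simp [planeWave, EuclideanSpace.inner_single_right]
  ring

theorem partialDeriv_const_mul (c : ℂ) {φ : Plane → ℂ} (hφ : ContDiff ℝ ∞ φ) (i : Fin 2)
    (x : Plane) : partialDeriv i (fun y => c * φ y) x = c * partialDeriv i φ x := by
  simp [partialDeriv, fderiv_const_mul ((hφ.differentiable (by simp)).differentiableAt (x := x))]

theorem sum_partialDeriv_partialDeriv_planeWave (k : ℝ) (η : Plane) (hη : ‖η‖ = 1) (x : Plane) :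
    ∑ i, partialDeriv i (partialDeriv i (planeWave k η)) x
      = -((k : ℂ) ^ 2 * planeWave k η x) := by
  have h : ∀ i, partialDeriv i (partialDeriv i (planeWave k η)) x
      = -(((k ^ 2 * (η i) ^ 2 : ℝ) : ℂ) * planeWave k η x) := fun i => by
    have : partialDeriv i (planeWave k η)
        = fun y => Complex.I * (k * η i : ℝ) * planeWave k η y :=
      funext (partialDeriv_planeWave k η i)
    rw [this, partialDeriv_const_mul _ (planeWave_contDiff k η), partialDeriv_planeWave]
    push_cast
    linear_combination ((k : ℂ) ^ 2 * (η i : ℂ) ^ 2 * planeWave k η x) * Complex.I_sq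
  have h2 : (η 0) ^ 2 + (η 1) ^ 2 = 1 := by
    have := EuclideanSpace.real_norm_sq_eq η
    rw [hη] at this
    simpa [Fin.sum_univ_two, eq_comm] using this
  rw [Fin.sum_univ_two, h, h]
  have h3 : ((η 0 : ℂ)) ^ 2 + (η 1 : ℂ) ^ 2 = 1 := by simpa using congrArg Complex.ofReal h2
  push_cast
  linear_combination (-(k : ℂ) ^ 2 * planeWave k η x) * h3

theorem sum_partialDeriv_planeWave_mul (k k' : ℝ) (η ξ x : Plane) :
    ∑ i, partialDeriv i (planeWave k η) x * partialDeriv i (planeWave k' ξ) x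
      = -((k * k' * inner ℝ η ξ : ℝ) * (planeWave k η x * planeWave k' ξ x)) := by
  have h : (inner ℝ η ξ : ℝ) = η 0 * ξ 0 + η 1 * ξ 1 := by
    simp [PiLp.inner_apply, Fin.sum_univ_two, mul_comm]
  rw [Fin.sum_univ_two, h]
  simp only [partialDeriv_planeWave]
  push_cast
  linear_combination ((k : ℂ) * k' * (η 0 * ξ 0 + η 1 * ξ 1) * planeWave k η x
    * planeWave k' ξ x) * Complex.I_sq

/-- A plane wave, cut off to a test function outside a neighbourhood of a bounded set. -/
theorem exists_isTestFunction_eq_planeWave {D : Set Plane} (hD : Bornology.IsBounded D)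
    (k : ℝ) (ξ : Plane) :
    ∃ φ, IsTestFunction φ ∧ ∀ x ∈ D, φ =ᶠ[𝓝 x] planeWave k ξ := by
  obtain ⟨R, hR0, hR⟩ := hD.subset_ball_lt 0 0
  let χ : ContDiffBump (0 : Plane) := ⟨R, R + 1, hR0, by linarith⟩
  refine ⟨fun x => (χ x : ℂ) * planeWave k ξ x, ⟨?_, ?_⟩, fun x hx => ?_⟩
  · exact (Complex.ofRealCLM.contDiff.comp χ.contDiff).mul (planeWave_contDiff k ξ)
  · exact HasCompactSupport.mul_right (χ.hasCompactSupport.comp_left (g := Complex.ofReal) rfl)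
  · filter_upwards [Metric.isOpen_ball.mem_nhds (hR hx)] with y hy
    simp [χ.one_of_mem_closedBall (Metric.ball_subset_closedBall hy)]

/-! ### Non-scattering waves -/

theorem integrable_sum_mul_partialDeriv {g : Fin 2 → Plane → ℂ} {φ : Plane → ℂ}
    (hg : ∀ i, LocallyIntegrable (g i)) (hφ : IsTestFunction φ) :
    Integrable fun x => ∑ i, g i x * partialDeriv i φ x :=
  integrable_finsetSum _ fun i _ => (hg i).integrable_mul_of_hasCompactSupport
    (hφ.partialDeriv i).1.continuous (hφ.partialDeriv i).2

/-- The weak form of the Helmholtz equation for a plane wave. -/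
theorem integral_planeWave_weakForm (k : ℝ) {η : Plane} (hη : ‖η‖ = 1) {φ : Plane → ℂ}
    (hφ : IsTestFunction φ) :
    ∫ x, (∑ i, partialDeriv i (planeWave k η) x * partialDeriv i φ x
      - (k : ℂ) ^ 2 * planeWave k η x * φ x) = 0 := by
  have hs := planeWave_contDiff k η
  have hp := fun i => partialDeriv_contDiff hs i
  have hpp := fun i => partialDeriv_contDiff (hp i) i
  have h1 : ∀ i, Integrable fun x => partialDeriv i (planeWave k η) x * partialDeriv i φ x :=
    fun i => (hp i).continuous.locallyIntegrable.integrable_mul_of_hasCompactSupport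
      (hφ.partialDeriv i).1.continuous (hφ.partialDeriv i).2
  have h2 : ∀ i, Integrable fun x => partialDeriv i (partialDeriv i (planeWave k η)) x * φ x :=
    fun i => (hpp i).continuous.locallyIntegrable.integrable_mul_of_hasCompactSupport
      hφ.1.continuous hφ.2
  have h3 : Integrable fun x => (k : ℂ) ^ 2 * planeWave k η x * φ x :=
    (continuous_const.mul hs.continuous).locallyIntegrable.integrable_mul_of_hasCompactSupport
      hφ.1.continuous hφ.2
  rw [integral_sub (integrable_finsetSum _ fun i _ => h1 i) h3,
    integral_finsetSum _ fun i _ => h1 i]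
  simp only [fun i => integral_mul_partialDeriv (hp i) hφ i]
  rw [Finset.sum_neg_distrib, ← integral_finsetSum _ fun i _ => h2 i, sub_eq_zero,
    ← integral_neg]
  refine integral_congr_ae (.of_forall fun x => ?_)
  simp only [← Finset.sum_mul, sum_partialDeriv_partialDeriv_planeWave k η hη]
  ring

/-- A function with a weak gradient that vanishes off `D` is orthogonal to the Helmholtz
solutions in `D`, up to the gradient term. -/
theorem integral_weakForm_eq_zero_of_ae_eq_off {D : Set Plane} {a q k : ℝ}
    {w : Plane → ℂ} {W : Fin 2 → Plane → ℂ} {φ : Plane → ℂ}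
    (hw : LocallyIntegrable w) (hW : ∀ i, LocallyIntegrable (W i)) (hφ : IsTestFunction φ)
    (hweak : ∀ i, ∫ x, w x * partialDeriv i (partialDeriv i φ) x
      = -∫ x, W i x * partialDeriv i φ x)
    (hoff : ∀ᵐ x, x ∉ D → w x = 0)
    (heq : ∀ x ∈ D, (a : ℂ) * ∑ i, partialDeriv i (partialDeriv i φ) x
      + (k : ℂ) ^ 2 * q * φ x = 0) :
    ∫ x, ((a : ℂ) * ∑ i, W i x * partialDeriv i φ x - (k : ℂ) ^ 2 * q * w x * φ x) = 0 := by
  have h1 : ∀ i, Integrable fun x => W i x * partialDeriv i φ x := fun i =>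
    (hW i).integrable_mul_of_hasCompactSupport (hφ.partialDeriv i).1.continuous
      (hφ.partialDeriv i).2
  have h2 : ∀ i, Integrable fun x => w x * partialDeriv i (partialDeriv i φ) x := fun i =>
    hw.integrable_mul_of_hasCompactSupport ((hφ.partialDeriv i).partialDeriv i).1.continuous
      ((hφ.partialDeriv i).partialDeriv i).2
  have h3 : Integrable fun x => w x * φ x :=
    hw.integrable_mul_of_hasCompactSupport hφ.1.continuous hφ.2
  have e1 : ∫ x, ∑ i, W i x * partialDeriv i φ x
      = -∫ x, ∑ i, w x * partialDeriv i (partialDeriv i φ) x := by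
    rw [integral_finsetSum _ fun i _ => h1 i, integral_finsetSum _ fun i _ => h2 i,
      ← Finset.sum_neg_distrib]
    exact Finset.sum_congr rfl fun i _ => by rw [hweak i, neg_neg]
  have h4 : Integrable fun x => (k : ℂ) ^ 2 * q * w x * φ x := by
    simpa only [mul_assoc] using (h3.const_mul (q : ℂ)).const_mul ((k : ℂ) ^ 2)
  have h5 := integrable_finsetSum Finset.univ fun i _ => h2 i
  rw [integral_sub ((integrable_finsetSum _ fun i _ => h1 i).const_mul _) h4,
    integral_const_mul, e1, mul_neg, ← integral_const_mul, ← integral_neg,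
    ← integral_sub (by simpa only [Pi.neg_def] using (h5.const_mul (a : ℂ)).neg) h4]
  refine integral_eq_zero_of_ae ?_
  filter_upwards [hoff] with x hx
  -- The equation for `φ` is needed only in `D`, because `w` vanishes elsewhere; a cut-off plane
  -- wave is thus an admissible `φ`.
  by_cases hxD : x ∈ D
  · simp only [← Finset.mul_sum, Pi.zero_apply]
    linear_combination (-w x) * heq x hxD
  · simp [hx hxD]

/-- If the plane wave with direction `η` is non-scattering, then its product with every plane wave
of the interior medium integrates to zero over `D`, up to an explicit factor. -/
theorem IsNonScattering.mul_integral_eq_zero {D : Set Plane} (hDo : IsOpen D)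
    (hDb : Bornology.IsBounded D) (hDc : Convex ℝ D) {a q n k : ℝ} (hq : q = a * n ^ 2)
    {η : Plane} (hη : ‖η‖ = 1) (h : IsNonScattering D a q k (planeWave k η))
    {ξ : Plane} (hξ : ‖ξ‖ = 1) :
    (((1 - a) * k * (k * n) * inner ℝ η ξ - k ^ 2 * (q - 1) : ℝ) : ℂ)
      * ∫ x in D, planeWave k η x * planeWave (k * n) ξ x = 0 := by
  -- The radiation condition is dropped: the scattered wave is already known to vanish outside `D`.
  obtain ⟨u, ⟨⟨g, hg, heq⟩, -⟩, hu⟩ := h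
  set p := planeWave k η with hp
  have hps : ContDiff ℝ ∞ p := planeWave_contDiff k η
  obtain ⟨φ, hφ, hφD⟩ := exists_isTestFunction_eq_planeWave hDb (k * n) ξ
  -- The boundary of a convex set is a null set.
  have hcl : ∀ᵐ x, x ∉ D → x ∈ (closure D)ᶜ := by
    have : ∀ᵐ x : Plane, x ∉ frontier D := measure_eq_zero_iff_ae_notMem.1
      (hDc.addHaar_frontier volume)
    filter_upwards [this] with x hx hxD hxc
    exact hx ⟨hxc, by rwa [hDo.interior_eq]⟩
  have hu' : ∀ᵐ x, x ∈ (closure D)ᶜ → u x = p x := by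
    rw [EventuallyEq, ae_restrict_iff' isClosed_closure.measurableSet.compl] at hu
    filter_upwards [hu] with x hx hxD using sub_eq_zero.1 (hx hxD)
  have hg' := fun i => hg.ae_eq_of_ae_eq hps isClosed_closure.isOpen_compl hu' i
  have hW : ∀ i, LocallyIntegrable fun x => g i x - partialDeriv i p x := fun i =>
    (hg.gradient_locallyL2 i).locallyIntegrable.sub
      (partialDeriv_contDiff hps i).continuous.locallyIntegrable
  have hw : LocallyIntegrable fun x => u x - p x :=
    hg.locallyL2.locallyIntegrable.sub hps.continuous.locallyIntegrable
  have I1 := integral_weakForm_eq_zero_of_ae_eq_off (D := D) (a := a) (q := q) (k := k)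
    hw hW hφ (fun i => hg.sub_contDiff hps (hφ.partialDeriv i) i)
    (by filter_upwards [hcl, hu'] with x h1 h2 h3 using sub_eq_zero.2 (h2 (h1 h3)))
    (fun x hx => by
      simp only [partialDeriv_partialDeriv_congr (hφD x hx),
        sum_partialDeriv_partialDeriv_planeWave _ _ hξ, (hφD x hx).eq_of_nhds, hq]
      push_cast
      ring)
  have I2 := integral_planeWave_weakForm k hη hφ
  have i1 : Integrable fun x => (a : ℂ) * ∑ i, (g i x - partialDeriv i p x) * partialDeriv i φ x
      - (k : ℂ) ^ 2 * q * (u x - p x) * φ x := by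
    refine ((integrable_sum_mul_partialDeriv hW hφ).const_mul _).sub ?_
    simpa only [mul_assoc] using
      ((hw.integrable_mul_of_hasCompactSupport hφ.1.continuous hφ.2).const_mul (q : ℂ)).const_mul
        ((k : ℂ) ^ 2)
  have i2 : Integrable fun x => ∑ i, partialDeriv i p x * partialDeriv i φ x
      - (k : ℂ) ^ 2 * p x * φ x :=
    (integrable_sum_mul_partialDeriv (fun i =>
      (partialDeriv_contDiff hps i).continuous.locallyIntegrable) hφ).sub
      ((continuous_const.mul hps.continuous).locallyIntegrable.integrable_mul_of_hasCompactSupport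
      hφ.1.continuous hφ.2)
  have i3 : Integrable fun x => D.indicator (fun x => (((1 - a) * k * (k * n) * inner ℝ η ξ
      - k ^ 2 * (q - 1) : ℝ) : ℂ) * (p x * planeWave (k * n) ξ x)) x := by
    rw [integrable_indicator_iff hDo.measurableSet]
    have hc : Continuous fun x => (((1 - a) * k * (k * n) * inner ℝ η ξ
      - k ^ 2 * (q - 1) : ℝ) : ℂ) * (p x * planeWave (k * n) ξ x) :=
      continuous_const.mul (hps.continuous.mul (planeWave_contDiff _ _).continuous)
    exact (hc.locallyIntegrable.integrableOn_isCompact hDb.isCompact_closure).mono_set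
      subset_closure
  have key := heq φ hφ
  rw [← integral_const_mul, ← integral_indicator hDo.measurableSet, ← key]
  -- Almost everywhere the weak-form integrand of `u` splits into three: the interior form of `u -
  -- p` (integral zero by `I1`), the background form of `p` (zero by `I2`), and the contrast of the
  -- coefficients applied to `p` in `D`, which is the indicator term.
  rw [← add_zero (∫ x, D.indicator _ x), ← I2, ← integral_add i3 i2,
    ← add_zero (∫ x, (_ + _)), ← I1, ← integral_add (by simpa only [Pi.add_def] using i3.add i2) i1]
  refine integral_congr_ae ?_
  filter_upwards [hcl, hu', hg' 0, hg' 1] with x h1 h2 h3 h4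
  by_cases hx : x ∈ D
  · have e := sum_partialDeriv_planeWave_mul k (k * n) η ξ x
    simp only [Fin.sum_univ_two] at e
    simp only [indicator_of_mem hx, coefficient, if_pos hx, partialDeriv_congr (hφD x hx),
      (hφD x hx).eq_of_nhds, Fin.sum_univ_two]
    push_cast at e ⊢
    linear_combination (1 - (a : ℂ)) * e
  · have h1 := h1 hx
    simp only [indicator_of_notMem hx, coefficient, if_neg hx, Fin.sum_univ_two, h2 h1, h3 h1,
      h4 h1]
    simp

/-! ### Fourier integrals of concave functions -/

/-- The increments of a strictly concave function over a fixed length are strictly decreasing. -/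
theorem StrictConcaveOn.increment_lt {s : Set ℝ} {f : ℝ → ℝ} (hf : StrictConcaveOn ℝ s f)
    {x y d : ℝ} (hx : x ∈ s) (hyd : y + d ∈ s) (hxy : x < y) (hd : 0 < d) :
    f (y + d) - f y < f (x + d) - f x := by
  have hL : 0 < y + d - x := by linarith
  -- Both `y` and `x + d` lie between `x` and `y + d`, with complementary weights; adding the two
  -- concavity inequalities gives the claim.
  set θ := d / (y + d - x) with hθ
  have hθ0 : 0 < θ := div_pos hd hL
  have hθ1 : θ < 1 := (div_lt_one hL).2 (by linarith)
  have e : θ * (y + d - x) = d := div_mul_cancel₀ d hL.ne'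
  have h1 := hf.2 hx hyd (by linarith : x ≠ y + d) hθ0 (sub_pos.2 hθ1) (by ring)
  have h2 := hf.2 hx hyd (by linarith : x ≠ y + d) (sub_pos.2 hθ1) hθ0 (by ring)
  simp only [smul_eq_mul] at h1 h2
  rw [show θ * x + (1 - θ) * (y + d) = y by linear_combination -e] at h1
  rw [show (1 - θ) * x + θ * (y + d) = x + d by linear_combination e] at h2
  linarith

/-- A strictly decreasing function, normalised to vanish at `c`, has positive integral against a
weight that changes sign from plus to minus at `c`. -/
theorem StrictAntiOn.integral_sub_mul_pos {h ρ : ℝ → ℝ} {a b c : ℝ}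
    (hh : StrictAntiOn h (Ioo a b)) (hc : c ∈ Ioo a b) (hi : IntervalIntegrable h volume a b)
    (hρ : Continuous ρ) (hpos : ∀ x ∈ Ioo a c, 0 < ρ x) (hneg : ∀ x ∈ Ioo c b, ρ x < 0) :
    h c * ∫ x in a..b, ρ x < ∫ x in a..b, h x * ρ x := by
  have i1 : IntervalIntegrable (fun x => h x * ρ x) volume a b :=
    hi.mul_continuousOn hρ.continuousOn
  have i2 : IntervalIntegrable (fun x => h c * ρ x) volume a b :=
    (continuous_const.mul hρ).intervalIntegrable _ _
  have i3 := i1.sub i2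
  have hcm : c ∈ uIcc a b := by
    rw [uIcc_of_le (hc.1.trans hc.2).le]; exact Ioo_subset_Icc_self hc
  have j1 := i3.mono_set (uIcc_subset_uIcc_left hcm)
  have j2 := i3.mono_set (uIcc_subset_uIcc_right hcm)
  -- The factors `h x - h c` and `ρ x` have the same sign on either side of `c`.
  have h1 := intervalIntegral.intervalIntegral_pos_of_pos_on j1 (fun x hx => by
    rw [← sub_mul]
    exact mul_pos (sub_pos.2 (hh ⟨hx.1, hx.2.trans hc.2⟩ hc hx.2)) (hpos x hx)) hc.1
  have h2 := intervalIntegral.intervalIntegral_pos_of_pos_on j2 (fun x hx => by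
    rw [← sub_mul]
    exact mul_pos_of_neg_of_neg (sub_neg.2 (hh hc ⟨hc.1.trans hx.1, hx.2⟩ hx.1)) (hneg x hx)) hc.2
  have h3 := intervalIntegral.integral_add_adjacent_intervals j1 j2
  have h4 := intervalIntegral.integral_sub i1 i2
  rw [intervalIntegral.integral_const_mul] at h4
  linarith

theorem integral_cos_mul_sub {τ : ℝ} (hτ : τ ≠ 0) (a b c : ℝ) :
    ∫ x in a..b, Real.cos (τ * (x - c))
      = (Real.sin (τ * (b - c)) - Real.sin (τ * (a - c))) / τ := by
  have h : ∀ x ∈ uIcc a b, HasDerivAt (fun x => Real.sin (τ * (x - c)) / τ)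
      (Real.cos (τ * (x - c))) x := fun x _ => by
    have := ((((hasDerivAt_id x).sub_const c).const_mul τ).sin).div_const τ
    simpa [hτ] using this
  rw [intervalIntegral.integral_eq_sub_of_hasDerivAt h
    ((by fun_prop : Continuous _).intervalIntegrable _ _), sub_div]

/-- Over one full period, a strictly concave function has negative cosine coefficient. -/
theorem StrictConcaveOn.integral_mul_cos_neg_period {f : ℝ → ℝ} {a d τ : ℝ} (hd : 0 < d)
    (hτd : τ * d = Real.pi) (hf : StrictConcaveOn ℝ (Ioo a (a + 2 * d)) f)
    (hi : IntervalIntegrable f volume a (a + 2 * d)) :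
    ∫ x in a..(a + 2 * d), f x * Real.cos (τ * (x - a)) < 0 := by
  have hπ := Real.pi_pos
  have hτ : 0 < τ := pos_of_mul_pos_left (hτd ▸ hπ) hd.le
  have hcos : Continuous fun x => Real.cos (τ * (x - a)) := by fun_prop
  have hm : a + d ∈ uIcc a (a + 2 * d) := by
    rw [uIcc_of_le (by linarith)]; constructor <;> linarith
  have i1 := hi.mono_set (uIcc_subset_uIcc_left hm)
  have i2 := hi.mono_set (uIcc_subset_uIcc_right hm)
  have i3 : IntervalIntegrable (fun x => f (x + d)) volume a (a + d) := by
    have := i2.comp_add_right d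
    simpa [show a + 2 * d - d = a + d by ring] using this
  have hF := hi.mul_continuousOn hcos.continuousOn
  have e1 := intervalIntegral.integral_add_adjacent_intervals
    (i1.mul_continuousOn hcos.continuousOn) (i2.mul_continuousOn hcos.continuousOn)
  -- A shift by the half period `d` flips the sign of the cosine, so the full integral is minus that
  -- of the increment `f (x + d) - f x` against the cosine over a half period. The increment is
  -- strictly decreasing, and the cosine has mean zero there and changes sign at `a + d / 2`.
  have e2 : ∫ x in (a + d)..(a + 2 * d), f x * Real.cos (τ * (x - a))
      = -∫ x in a..(a + d), f (x + d) * Real.cos (τ * (x - a)) := by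
    rw [← intervalIntegral.integral_neg, show a + 2 * d = a + d + d by ring,
      ← intervalIntegral.integral_comp_add_right (fun x => f x * Real.cos (τ * (x - a)))]
    refine intervalIntegral.integral_congr fun x _ => ?_
    rw [show τ * (x + d - a) = τ * (x - a) + Real.pi by linear_combination hτd, Real.cos_add_pi]
    ring
  have e3 := intervalIntegral.integral_sub (i3.mul_continuousOn hcos.continuousOn)
    (i1.mul_continuousOn hcos.continuousOn)
  have hanti : StrictAntiOn (fun x => f (x + d) - f x) (Ioo a (a + d)) := fun x hx y hy hxy =>
    hf.increment_lt ⟨hx.1, by linarith [hx.2]⟩ ⟨by linarith [hy.1], by linarith [hy.2]⟩ hxy hd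
  have hcd : τ * (d / 2) = Real.pi / 2 := by linear_combination hτd / 2
  have key := hanti.integral_sub_mul_pos (c := a + d / 2) ⟨by linarith, by linarith⟩ (i3.sub i1)
    hcos (fun x hx => Real.cos_pos_of_mem_Ioo ⟨by nlinarith [hx.1], by nlinarith [hx.2]⟩)
    (fun x hx => Real.cos_neg_of_pi_div_two_lt_of_lt (by nlinarith [hx.1]) (by nlinarith [hx.2]))
  rw [integral_cos_mul_sub hτ.ne', show τ * (a + d - a) = Real.pi by linear_combination hτd] at key
  simp only [sub_self, mul_zero, Real.sin_pi, Real.sin_zero, zero_div, sub_mul] at key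
  linarith

/-- Over finitely many full periods, a strictly concave function has negative cosine
coefficient. -/
theorem StrictConcaveOn.integral_mul_cos_neg {f : ℝ → ℝ} {α β τ : ℝ} (hαβ : α < β) {m : ℕ}
    (hm : 0 < m) (hτ : τ * (β - α) = 2 * Real.pi * m) (hf : StrictConcaveOn ℝ (Ioo α β) f)
    (hi : IntervalIntegrable f volume α β) :
    ∫ x in α..β, f x * Real.cos (τ * (x - α)) < 0 := by
  have hm' : (0 : ℝ) < m := by exact_mod_cast hm
  -- Half a period: `m` full periods of length `2 * d` fill the interval, and each contributes a
  -- negative amount.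
  set d := (β - α) / (2 * m) with hd
  have hd0 : 0 < d := div_pos (by linarith) (by linarith)
  have hdm : 2 * m * d = β - α := by rw [hd]; field_simp
  have hτd : τ * d = Real.pi := by
    have : (2 * m) * (τ * d) = (2 * m) * Real.pi := by linear_combination τ * hdm + hτ
    exact mul_left_cancel₀ (by positivity) this
  let p : ℕ → ℝ := fun j => α + 2 * d * j
  have hpm : p m = β := by simp only [p]; linear_combination hdm
  have hp0 : p 0 = α := by simp [p]
  have hps : ∀ j, p (j + 1) = p j + 2 * d := fun j => by simp only [p]; push_cast; ring
  have hpj : ∀ j, α ≤ p j := fun j => by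
    have : 0 ≤ 2 * d * (j : ℝ) := by positivity
    simp only [p]; linarith
  have hpj' : ∀ j < m, p (j + 1) ≤ β := fun j hj => by
    have : ((j + 1 : ℕ) : ℝ) ≤ m := by exact_mod_cast hj
    have := mul_le_mul_of_nonneg_left this (by positivity : 0 ≤ 2 * d)
    simp only [p] at hpm ⊢
    linarith
  have hij : ∀ j < m, IntervalIntegrable f volume (p j) (p (j + 1)) := fun j hj => by
    refine hi.mono_set ?_
    rw [uIcc_of_le hαβ.le, uIcc_of_le (by rw [hps]; linarith)]
    exact Icc_subset_Icc (hpj j) (hpj' j hj)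
  have hsum := intervalIntegral.sum_integral_adjacent_intervals
    (f := fun x => f x * Real.cos (τ * (x - α))) (a := p) (n := m) fun j hj =>
      (hij j hj).mul_continuousOn (by fun_prop : Continuous _).continuousOn
  rw [hp0, hpm] at hsum
  rw [← hsum]
  refine Finset.sum_neg (fun j hj => ?_) ⟨0, Finset.mem_range.2 hm⟩
  have hj := Finset.mem_range.1 hj
  have h1 := hij j hj
  have h2 := hpj' j hj
  rw [hps] at h1 h2 ⊢
  have hc : ∀ x, Real.cos (τ * (x - α)) = Real.cos (τ * (x - p j)) := fun x => by
    rw [show τ * (x - p j) = τ * (x - α) - j * (2 * Real.pi) by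
      simp only [p]; linear_combination (-2 * (j : ℝ)) * hτd, Real.cos_sub_nat_mul_two_pi]
  simp only [hc]
  exact (hf.subset (Ioo_subset_Ioo (hpj j) h2) (convex_Ioo _ _)).integral_mul_cos_neg_period
    hd0 hτd h1

/-- Over less than one period, a positive strictly concave function has positive cosine
coefficient with respect to the midpoint. -/
theorem StrictConcaveOn.integral_mul_cos_pos {f : ℝ → ℝ} {c L t : ℝ} (hL : 0 < L) (ht : 0 < t)
    (htL : t * L < Real.pi) (hf : StrictConcaveOn ℝ (Ioo (c - L) (c + L)) f)
    (hpos : ∀ x ∈ Ioo (c - L) (c + L), 0 < f x)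
    (hi : IntervalIntegrable f volume (c - L) (c + L)) :
    0 < ∫ x in (c - L)..(c + L), f x * Real.cos (t * (x - c)) := by
  have hcos : Continuous fun x => Real.cos (t * (x - c)) := by fun_prop
  rcases le_or_gt (t * L) (Real.pi / 2) with h | h
  · refine intervalIntegral.intervalIntegral_pos_of_pos_on
      (hi.mul_continuousOn hcos.continuousOn) (fun x hx => mul_pos (hpos x hx) ?_) (by linarith)
    exact Real.cos_pos_of_mem_Ioo ⟨by nlinarith [hx.1], by nlinarith [hx.2]⟩
  have hm : c ∈ uIcc (c - L) (c + L) := by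
    rw [uIcc_of_le (by linarith)]; constructor <;> linarith
  have i1 := hi.mono_set (uIcc_subset_uIcc_left hm)
  have i2 := hi.mono_set (uIcc_subset_uIcc_right hm)
  have i3 : IntervalIntegrable (fun x => f (2 * c - x)) volume c (c + L) := by
    have := i1.comp_sub_left (2 * c)
    rw [show 2 * c - (c - L) = c + L by ring, show 2 * c - c = c by ring] at this
    exact this.symm
  have e1 := intervalIntegral.integral_add_adjacent_intervals
    (i1.mul_continuousOn hcos.continuousOn) (i2.mul_continuousOn hcos.continuousOn)
  -- Folding at the midpoint, where the cosine is even, replaces `f` by `f (2 * c - x) + f x`, which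
  -- is strictly decreasing on the right half.
  have e2 : ∫ x in (c - L)..c, f x * Real.cos (t * (x - c))
      = ∫ x in c..(c + L), f (2 * c - x) * Real.cos (t * (x - c)) := by
    have := intervalIntegral.integral_comp_sub_left (a := c) (b := c + L)
      (fun x => f x * Real.cos (t * (x - c))) (2 * c)
    rw [show 2 * c - (c + L) = c - L by ring, show 2 * c - c = c by ring] at this
    rw [← this]
    refine intervalIntegral.integral_congr fun x _ => ?_
    rw [← Real.cos_neg]
    ring_nf
  have e3 := intervalIntegral.integral_add (i3.mul_continuousOn hcos.continuousOn)
    (i2.mul_continuousOn hcos.continuousOn)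
  have hanti : StrictAntiOn (fun x => f (2 * c - x) + f x) (Ioo c (c + L)) := by
    intro x hx y hy hxy
    -- The increments compared are those from `2 * c - y` to `2 * c - x` and from `x` to `y`, of
    -- equal length.
    have := hf.increment_lt (x := 2 * c - y) (y := x) (d := y - x)
      ⟨by linarith [hy.2], by linarith [hy.1]⟩ ⟨by linarith [hy.1], by linarith [hy.2]⟩
      (by linarith [hx.1, hy.1]) (by linarith)
    rw [show x + (y - x) = y by ring, show 2 * c - y + (y - x) = 2 * c - x by ring] at this
    simp only
    linarith
  -- The offset from `c` at which the cosine changes sign; it falls inside the interval since `t * L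
  -- > π / 2` in this case.
  set r := Real.pi / 2 / t with hr
  have htr : t * r = Real.pi / 2 := mul_div_cancel₀ _ ht.ne'
  have hr0 : 0 < r := div_pos (by positivity) ht
  have hrL : r < L := by nlinarith
  have hcr : c + r ∈ Ioo c (c + L) := ⟨by linarith, by linarith⟩
  have key := hanti.integral_sub_mul_pos hcr (i3.add i2) hcos
    (fun x hx => Real.cos_pos_of_mem_Ioo ⟨by nlinarith [hx.1], by nlinarith [hx.2]⟩)
    (fun x hx => Real.cos_neg_of_pi_div_two_lt_of_lt (by nlinarith [hx.1]) (by nlinarith [hx.2]))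
  rw [integral_cos_mul_sub ht.ne'] at key
  -- Here `t * L < π` enters: the cosine integral over the right half is `sin (t * L) / t > 0`.
  have hp : 0 < (f (2 * c - (c + r)) + f (c + r))
      * ((Real.sin (t * (c + L - c)) - Real.sin (t * (c - c))) / t) := by
    refine mul_pos (add_pos (hpos _ ⟨by linarith, by linarith⟩)
      (hpos _ ⟨by linarith, by linarith⟩)) (div_pos ?_ ht)
    have := Real.sin_pos_of_pos_of_lt_pi (by positivity) htL
    simpa using this
  simp only [add_mul] at key hp
  linarith

/-! ### Sections of strictly convex domains -/

/-- The rotation of a vector by a right angle. -/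
noncomputable def rotateVec (l : Plane) : Plane := !₂[-l 1, l 0]

theorem Plane.inner_eq (x y : Plane) : (inner ℝ x y : ℝ) = x 0 * y 0 + x 1 * y 1 := by
  simp [PiLp.inner_apply, Fin.sum_univ_two, mul_comm]

theorem inner_rotateVec (l : Plane) : (inner ℝ l (rotateVec l) : ℝ) = 0 := by
  rw [Plane.inner_eq]; simp [rotateVec]; ring

theorem inner_combo {l : Plane} (hl : ‖l‖ = 1) (s y : ℝ) :
    (inner ℝ l (s • l + y • rotateVec l) : ℝ) = s := by
  rw [inner_add_right, inner_smul_right, inner_smul_right, inner_rotateVec,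
    real_inner_self_eq_norm_sq, hl]
  ring

theorem combo_inner {l : Plane} (hl : ‖l‖ = 1) (x : Plane) :
    (inner ℝ l x : ℝ) • l + (inner ℝ (rotateVec l) x : ℝ) • rotateVec l = x := by
  have h : l 0 * l 0 + l 1 * l 1 = 1 := by
    rw [← Plane.inner_eq, real_inner_self_eq_norm_sq, hl, one_pow]
  ext i
  fin_cases i
  · simp [Plane.inner_eq, rotateVec]; linear_combination x 0 * h
  · simp [Plane.inner_eq, rotateVec]; linear_combination x 1 * h

theorem orthonormal_rotateVec {l : Plane} (hl : ‖l‖ = 1) : Orthonormal ℝ ![l, rotateVec l] := by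
  have h1 : ‖rotateVec l‖ = 1 := by
    have h2 : ‖rotateVec l‖ ^ 2 = 1 := by
      rw [← real_inner_self_eq_norm_sq]
      have : (inner ℝ l l : ℝ) = 1 := by rw [real_inner_self_eq_norm_sq, hl, one_pow]
      rw [Plane.inner_eq] at this ⊢
      simp only [rotateVec]
      simp
      linarith
    nlinarith [norm_nonneg (rotateVec l)]
  refine ⟨fun i => by fin_cases i <;> simpa, fun i j hij => ?_⟩
  fin_cases i <;> fin_cases j <;> simp_all [inner_rotateVec, real_inner_comm l]

/-- Cartesian coordinates adapted to a unit vector. -/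
theorem exists_measurableEquiv_combo {l : Plane} (hl : ‖l‖ = 1) :
    ∃ e : ℝ × ℝ ≃ᵐ Plane, MeasurePreserving e ∧ ∀ z, e z = z.1 • l + z.2 • rotateVec l := by
  have hsp : ⊤ ≤ Submodule.span ℝ (range ![l, rotateVec l]) := by
    intro x _
    rw [← combo_inner hl x]
    refine add_mem (Submodule.smul_mem _ _ (Submodule.subset_span ⟨0, rfl⟩))
      (Submodule.smul_mem _ _ (Submodule.subset_span ⟨1, rfl⟩))
  let b := OrthonormalBasis.mk (orthonormal_rotateVec hl) hsp
  refine ⟨MeasurableEquiv.finTwoArrow.symm.trans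
    ((MeasurableEquiv.toLp 2 (Fin 2 → ℝ)).trans b.measurableEquiv.symm), ?_, fun z => ?_⟩
  · exact ((b.measurePreserving_measurableEquiv.symm _).comp
      ((EuclideanSpace.volume_preserving_symm_measurableEquiv_toLp (Fin 2)).symm _)).comp
      ((volume_preserving_finTwoArrow ℝ).symm _)
  · change b.repr.symm _ = _
    rw [← b.sum_repr_symm]
    simp [Fin.sum_univ_two, b]

/-- An open convex set is the interior of its closure, so strict convexity of the closure puts the
point into `D` itself. -/
theorem IsStrictlyConvexDomain.combo_mem {D : Set Plane} (hD : IsStrictlyConvexDomain D)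
    {x y : Plane} (hx : x ∈ closure D) (hy : y ∈ closure D) (hxy : x ≠ y) {a b : ℝ} (ha : 0 < a)
    (hb : 0 < b) (hab : a + b = 1) : a • x + b • y ∈ D := by
  have h := hD.strictConvex hx hy hxy ha hb hab
  rwa [hD.convex.interior_closure_eq_interior_of_nonempty_interior
    (by rw [hD.isOpen.interior_eq]; exact hD.nonempty), hD.isOpen.interior_eq] at h

theorem IsOpen.lt_csSup_of_mem {S : Set ℝ} (hS : IsOpen S) (hb : BddAbove S) {x : ℝ}
    (hx : x ∈ S) : x < sSup S := by
  obtain ⟨y, hy, hyS⟩ := (mem_nhdsGT_iff_exists_Ioo_subset.1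
    (mem_nhdsWithin_of_mem_nhds (hS.mem_nhds hx)) : ∃ u ∈ Ioi x, Ioo x u ⊆ S)
  have hy : x < y := hy
  have := le_csSup hb (hyS ⟨left_lt_add_div_two.2 hy, add_div_two_lt_right.2 hy⟩)
  linarith [left_lt_add_div_two.2 hy]

theorem IsOpen.csInf_lt_of_mem {S : Set ℝ} (hS : IsOpen S) (hb : BddBelow S) {x : ℝ}
    (hx : x ∈ S) : sInf S < x := by
  obtain ⟨y, hy, hyS⟩ := (mem_nhdsLT_iff_exists_Ioo_subset.1
    (mem_nhdsWithin_of_mem_nhds (hS.mem_nhds hx)) : ∃ u ∈ Iio x, Ioo u x ⊆ S)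
  have hy : y < x := hy
  have := csInf_le hb (hyS ⟨left_lt_add_div_two.2 hy, add_div_two_lt_right.2 hy⟩)
  linarith [add_div_two_lt_right.2 hy]

theorem volume_real_eq_sSup_sub_sInf {S : Set ℝ} (hS : IsConnected S)
    (hb : BddBelow S) (ha : BddAbove S) : volume.real S = sSup S - sInf S := by
  have hle : sInf S ≤ sSup S := csInf_le_csSup hS.nonempty hb ha
  have h1 := hS.Ioo_csInf_csSup_subset hb ha
  have h2 := subset_Icc_csInf_csSup hb ha
  refine le_antisymm ?_ ?_
  · have := measureReal_mono (μ := volume) h2 (by simp)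
    simpa [hle] using this
  · have := measureReal_mono (μ := volume) h1 ((measure_mono h2).trans_lt (by simp)).ne
    simpa [hle] using this

/-- The section of `D` at height `s` in the direction `l`. -/
def lineSection (D : Set Plane) (l : Plane) (s : ℝ) : Set ℝ := {y | s • l + y • rotateVec l ∈ D}

section
variable {D : Set Plane} {l : Plane}

theorem IsStrictlyConvexDomain.isOpen_lineSection (hD : IsStrictlyConvexDomain D) (s : ℝ) :
    IsOpen (lineSection D l s) :=
  hD.isOpen.preimage (by fun_prop : Continuous fun y : ℝ => s • l + y • rotateVec l)

theorem IsStrictlyConvexDomain.isPreconnected_lineSection (hD : IsStrictlyConvexDomain D)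
    (s : ℝ) : IsPreconnected (lineSection D l s) := by
  refine Convex.isPreconnected fun x hx y hy a b ha hb hab => ?_
  have := hD.convex hx hy ha hb hab
  simp only [lineSection, mem_ofPred_eq]
  convert this using 1
  simp only [smul_add, smul_smul, smul_eq_mul, add_smul]
  have : s • l = (a * s) • l + (b * s) • l := by rw [← add_smul, ← add_mul, hab, one_mul]
  rw [this]
  abel

theorem IsStrictlyConvexDomain.isBounded_lineSection (hD : IsStrictlyConvexDomain D)
    (hl : ‖l‖ = 1) (s : ℝ) : Bornology.IsBounded (lineSection D l s) := by
  obtain ⟨R, hR⟩ := hD.isBounded.exists_norm_le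
  refine isBounded_iff_forall_norm_le.2 ⟨R, fun y hy => ?_⟩
  have h1 : (inner ℝ (rotateVec l) (s • l + y • rotateVec l) : ℝ) = y := by
    have h := (orthonormal_rotateVec hl).1 1
    simp only [Matrix.cons_val_one, Matrix.cons_val_fin_one] at h
    rw [inner_add_right, inner_smul_right, inner_smul_right, real_inner_comm, inner_rotateVec,
      real_inner_self_eq_norm_sq, h]
    ring
  have h := (orthonormal_rotateVec hl).1 1
  simp only [Matrix.cons_val_one, Matrix.cons_val_fin_one] at h
  have h2 := abs_real_inner_le_norm (rotateVec l) (s • l + y • rotateVec l)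
  rw [h1, h, one_mul] at h2
  exact h2.trans (hR _ hy)

theorem IsStrictlyConvexDomain.isBounded_image_inner (hD : IsStrictlyConvexDomain D) (l : Plane) :
    Bornology.IsBounded ((fun x : Plane => (inner ℝ l x : ℝ)) '' D) := by
  exact (innerSL ℝ l).lipschitz.isBounded_image hD.isBounded

theorem IsStrictlyConvexDomain.nonempty_lineSection (hD : IsStrictlyConvexDomain D)
    (hl : ‖l‖ = 1) {s : ℝ} (hs : s ∈ Ioo (sInf ((fun x : Plane => (inner ℝ l x : ℝ)) '' D))
      (sSup ((fun x : Plane => (inner ℝ l x : ℝ)) '' D))) : (lineSection D l s).Nonempty := by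
  have hp : IsConnected ((fun x : Plane => (inner ℝ l x : ℝ)) '' D) :=
    (hD.convex.isConnected hD.nonempty).image _ (innerSL ℝ l).continuous.continuousOn
  obtain ⟨x, hx, rfl⟩ := hp.Ioo_csInf_csSup_subset (hD.isBounded_image_inner l).bddBelow
    (hD.isBounded_image_inner l).bddAbove hs
  exact ⟨inner ℝ (rotateVec l) x, by simpa [lineSection, combo_inner hl] using hx⟩

theorem IsStrictlyConvexDomain.inner_mem_Ioo (hD : IsStrictlyConvexDomain D) (hl : ‖l‖ = 1)
    {x : Plane} (hx : x ∈ D) : (inner ℝ l x : ℝ) ∈ Ioo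
      (sInf ((fun x : Plane => (inner ℝ l x : ℝ)) '' D))
      (sSup ((fun x : Plane => (inner ℝ l x : ℝ)) '' D)) := by
  have ho : IsOpen ((fun x : Plane => (inner ℝ l x : ℝ)) '' D) := by
    refine (innerSL ℝ l).isOpenMap_of_ne_zero (fun h => ?_) D hD.isOpen
    have := congrArg (fun f => f l) h
    simp [hl] at this
  have hm : (inner ℝ l x : ℝ) ∈ (fun x : Plane => (inner ℝ l x : ℝ)) '' D := ⟨x, hx, rfl⟩
  exact ⟨ho.csInf_lt_of_mem (hD.isBounded_image_inner l).bddBelow hm,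
    ho.lt_csSup_of_mem (hD.isBounded_image_inner l).bddAbove hm⟩

theorem IsStrictlyConvexDomain.lineSection_eq_empty (hD : IsStrictlyConvexDomain D)
    (hl : ‖l‖ = 1) {s : ℝ} (hs : s ∉ Ioo (sInf ((fun x : Plane => (inner ℝ l x : ℝ)) '' D))
      (sSup ((fun x : Plane => (inner ℝ l x : ℝ)) '' D))) : lineSection D l s = ∅ := by
  exact eq_empty_of_forall_notMem fun y hy => hs
    (inner_combo hl s y ▸ hD.inner_mem_Ioo hl (x := s • l + y • rotateVec l) hy)

theorem IsStrictlyConvexDomain.lineSection_combo_mem (hD : IsStrictlyConvexDomain D)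
    (hl : ‖l‖ = 1) {s t y z : ℝ} (hy : y ∈ closure (lineSection D l s))
    (hz : z ∈ closure (lineSection D l t)) (hst : s ≠ t) {a b : ℝ} (ha : 0 < a) (hb : 0 < b)
    (hab : a + b = 1) : a * y + b * z ∈ lineSection D l (a * s + b * t) := by
  have hc : ∀ r v, v ∈ closure (lineSection D l r) → r • l + v • rotateVec l ∈ closure D :=
    fun r v hv =>
    (by fun_prop : Continuous fun y : ℝ => r • l + y • rotateVec l).closure_preimage_subset D hv
  have := hD.combo_mem (hc s y hy) (hc t z hz) (fun h => hst ?_) ha hb hab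
  · simp only [lineSection, mem_ofPred_eq]
    convert this using 1
    module
  · rw [← inner_combo hl s y, h, inner_combo hl]

/-- The length of the sections of a strictly convex domain is strictly concave. -/
theorem IsStrictlyConvexDomain.strictConcaveOn_volume_lineSection (hD : IsStrictlyConvexDomain D)
    (hl : ‖l‖ = 1) : StrictConcaveOn ℝ (Ioo (sInf ((fun x : Plane => (inner ℝ l x : ℝ)) '' D))
      (sSup ((fun x : Plane => (inner ℝ l x : ℝ)) '' D)))
      fun s => volume.real (lineSection D l s) := by
  refine ⟨convex_Ioo _ _, fun s hs t ht hst a b ha hb hab => ?_⟩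
  have hm := convex_Ioo _ _ hs ht ha.le hb.le hab
  have hbd := fun r => hD.isBounded_lineSection hl r
  have hv : ∀ r ∈ Ioo (sInf ((fun x : Plane => (inner ℝ l x : ℝ)) '' D))
      (sSup ((fun x : Plane => (inner ℝ l x : ℝ)) '' D)), volume.real (lineSection D l r)
      = sSup (lineSection D l r) - sInf (lineSection D l r) := fun r hr =>
    volume_real_eq_sSup_sub_sInf ⟨hD.nonempty_lineSection hl hr, hD.isPreconnected_lineSection r⟩
      (hbd r).bddBelow (hbd r).bddAbove
  simp only [hv _ hs, hv _ ht, hv _ hm]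
  -- Combining the upper endpoints of two sections gives a point of the open intermediate section,
  -- hence one strictly below its supremum; likewise for the lower endpoints.
  have h1 := hD.lineSection_combo_mem hl
    (csSup_mem_closure (hD.nonempty_lineSection hl hs) (hbd s).bddAbove)
    (csSup_mem_closure (hD.nonempty_lineSection hl ht) (hbd t).bddAbove) hst ha hb hab
  have h2 := hD.lineSection_combo_mem hl
    (csInf_mem_closure (hD.nonempty_lineSection hl hs) (hbd s).bddBelow)
    (csInf_mem_closure (hD.nonempty_lineSection hl ht) (hbd t).bddBelow) hst ha hb hab
  have h3 := (hD.isOpen_lineSection _).lt_csSup_of_mem (hbd _).bddAbove h1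
  have h4 := (hD.isOpen_lineSection _).csInf_lt_of_mem (hbd _).bddBelow h2
  simp only [smul_eq_mul]
  linarith

theorem IsStrictlyConvexDomain.volume_lineSection_pos (hD : IsStrictlyConvexDomain D)
    (hl : ‖l‖ = 1) {s : ℝ} (hs : s ∈ Ioo (sInf ((fun x : Plane => (inner ℝ l x : ℝ)) '' D))
      (sSup ((fun x : Plane => (inner ℝ l x : ℝ)) '' D))) :
    0 < volume.real (lineSection D l s) :=
  ENNReal.toReal_pos ((hD.isOpen_lineSection s).measure_pos _
    (hD.nonempty_lineSection hl hs)).ne' (hD.isBounded_lineSection hl s).measure_lt_top.ne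

end

/-! ### The Fourier transform of a strictly convex domain -/

section
variable {D : Set Plane} {l : Plane}

/-- Fubini in the orthonormal coordinates along `l` and `rotateVec l`: the integrand depends on the
first coordinate only. -/
theorem IsStrictlyConvexDomain.integrable_volume_lineSection_mul (hD : IsStrictlyConvexDomain D)
    (hl : ‖l‖ = 1) {ρ : ℝ → ℝ} (hρ : Continuous ρ) :
    Integrable (fun s => volume.real (lineSection D l s) * ρ s) ∧
      ∫ x in D, ρ (inner ℝ l x) = ∫ s, volume.real (lineSection D l s) * ρ s := by
  obtain ⟨e, he, hez⟩ := exists_measurableEquiv_combo hl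
  have hi : IntegrableOn (fun x => ρ (inner ℝ l x)) D :=
    (((hρ.comp (innerSL ℝ l).continuous).locallyIntegrable).integrableOn_isCompact
      hD.isBounded.isCompact_closure).mono_set subset_closure
  have hE : MeasurableSet (e ⁻¹' D) := e.measurable hD.isOpen.measurableSet
  have hi2 : Integrable ((e ⁻¹' D).indicator fun z => ρ z.1) (volume.prod volume) := by
    rw [integrable_indicator_iff hE]
    refine ((he.integrableOn_comp_preimage e.measurableEmbedding).2 hi).congr_fun ?_ hE
    intro z _
    simp [hez, inner_combo hl]
  have hs : ∀ s, ∫ y, (e ⁻¹' D).indicator (fun z => ρ z.1) (s, y)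
      = volume.real (lineSection D l s) * ρ s := fun s => by
    rw [← smul_eq_mul, ← integral_indicator_const _ (hD.isOpen_lineSection s).measurableSet]
    refine integral_congr_ae (.of_forall fun y => ?_)
    have hm : (s, y) ∈ e ⁻¹' D ↔ y ∈ lineSection D l s := by rw [mem_preimage, hez]; rfl
    by_cases h : y ∈ lineSection D l s
    · simp [indicator_of_mem h, indicator_of_mem (hm.2 h)]
    · simp [indicator_of_notMem h, indicator_of_notMem (mt hm.1 h)]
  constructor
  · simpa only [hs] using hi2.integral_prod_left
  · rw [← he.setIntegral_preimage_emb e.measurableEmbedding, ← integral_congr_ae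
      (.of_forall hs), ← integral_prod _ hi2, integral_indicator hE]
    refine setIntegral_congr_fun hE fun z _ => ?_
    simp [hez, inner_combo hl]

theorem IsStrictlyConvexDomain.integral_comp_inner (hD : IsStrictlyConvexDomain D)
    (hl : ‖l‖ = 1) {ρ : ℝ → ℝ} (hρ : Continuous ρ) :
    ∫ x in D, ρ (inner ℝ l x) =
      ∫ s in (sInf ((fun x : Plane => (inner ℝ l x : ℝ)) '' D))..
        (sSup ((fun x : Plane => (inner ℝ l x : ℝ)) '' D)),
        volume.real (lineSection D l s) * ρ s := by
  obtain ⟨x, hx⟩ := hD.nonempty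
  have h := hD.inner_mem_Ioo hl hx
  rw [(hD.integrable_volume_lineSection_mul hl hρ).2,
    intervalIntegral.integral_of_le (h.1.trans h.2).le, eq_comm]
  refine setIntegral_eq_integral_of_forall_compl_eq_zero fun s hs => ?_
  rw [hD.lineSection_eq_empty hl fun h => hs (Ioo_subset_Ioc_self h)]
  simp

theorem IsStrictlyConvexDomain.integrable_volume_lineSection (hD : IsStrictlyConvexDomain D)
    (hl : ‖l‖ = 1) : Integrable fun s => volume.real (lineSection D l s) := by
  simpa using (hD.integrable_volume_lineSection_mul hl (continuous_const (y := (1 : ℝ)))).1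

/-- Multiplying by the phase `exp (-i t c)` keeps the integral zero, and the real part remains. The
free `c` is later the left endpoint or the midpoint of the projection of `D`. -/
theorem integral_cos_eq_zero_of_integral_planeWave (hD : Bornology.IsBounded D) {t : ℝ}
    (h : ∫ x in D, planeWave t l x = 0) (c : ℝ) :
    ∫ x in D, Real.cos (t * (inner ℝ l x - c)) = 0 := by
  have hi : IntegrableOn (fun x => Complex.exp (-(Complex.I * (t * c : ℝ))) * planeWave t l x) D :=
    ((continuous_const.mul (planeWave_contDiff t l).continuous).locallyIntegrable
      |>.integrableOn_isCompact hD.isCompact_closure).mono_set subset_closure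
  have h1 := Complex.reCLM.integral_comp_comm hi
  rw [integral_const_mul, h, mul_zero, map_zero] at h1
  rw [← h1]
  refine integral_congr_ae (.of_forall fun x => ?_)
  simp only [planeWave, Complex.reCLM_apply]
  rw [← Complex.exp_add, show -(Complex.I * ((t * c : ℝ) : ℂ))
      + Complex.I * ((t * inner ℝ l x : ℝ) : ℂ) = ((t * (inner ℝ l x - c) : ℝ) : ℂ) * Complex.I by
    push_cast; ring, Complex.exp_ofReal_mul_I_re]

/-- The Fourier transform of the indicator function of a strictly convex domain does not vanish at
frequencies that are multiples of `2π` over the width. -/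
theorem IsStrictlyConvexDomain.mul_width_ne (hD : IsStrictlyConvexDomain D) (hl : ‖l‖ = 1)
    {t : ℝ} (h : ∫ x in D, planeWave t l x = 0) {m : ℕ} (hm : 0 < m) :
    t * width D l ≠ 2 * Real.pi * m := by
  intro htm
  obtain ⟨x, hx⟩ := hD.nonempty
  have hx := hD.inner_mem_Ioo hl hx
  have h1 := (hD.strictConcaveOn_volume_lineSection hl).integral_mul_cos_neg (hx.1.trans hx.2) hm
    htm (hD.integrable_volume_lineSection hl).intervalIntegrable
  rw [← hD.integral_comp_inner hl (ρ := fun s => Real.cos (t * (s - _))) (by fun_prop),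
    integral_cos_eq_zero_of_integral_planeWave hD.isBounded h] at h1
  exact lt_irrefl _ h1

/-- The Fourier transform of the indicator function of a strictly convex domain does not vanish at
frequencies below `2π` over the width. -/
theorem IsStrictlyConvexDomain.two_pi_le_mul_width (hD : IsStrictlyConvexDomain D) (hl : ‖l‖ = 1)
    {t : ℝ} (ht : 0 < t) (h : ∫ x in D, planeWave t l x = 0) :
    2 * Real.pi ≤ t * width D l := by
  by_contra! htm
  obtain ⟨x, hx⟩ := hD.nonempty
  have hx := hD.inner_mem_Ioo hl hx
  have hconc := hD.strictConcaveOn_volume_lineSection hl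
  have hpos := fun s hs => hD.volume_lineSection_pos hl (s := s) hs
  have hint := fun ρ hρ => hD.integral_comp_inner hl (ρ := ρ) hρ
  rw [width] at htm
  set α := sInf ((fun x : Plane => (inner ℝ l x : ℝ)) '' D)
  set β := sSup ((fun x : Plane => (inner ℝ l x : ℝ)) '' D)
  have e1 : α = (α + β) / 2 - (β - α) / 2 := by ring
  have e2 : β = (α + β) / 2 + (β - α) / 2 := by ring
  have h1 := StrictConcaveOn.integral_mul_cos_pos (f := fun s => volume.real (lineSection D l s))
    (c := (α + β) / 2) (L := (β - α) / 2) (t := t) (by linarith [hx.1, hx.2]) ht (by linarith)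
    (by rwa [← e1, ← e2]) (by rwa [← e1, ← e2])
    (hD.integrable_volume_lineSection hl).intervalIntegrable
  rw [← e1, ← e2, ← hint (fun s => Real.cos (t * (s - (α + β) / 2))) (by fun_prop),
    integral_cos_eq_zero_of_integral_planeWave hD.isBounded h] at h1
  exact lt_irrefl _ h1

/-! ### The width function -/

/-- The support function of a set inside a ball of radius `R` about the origin is `R`-Lipschitz. -/
theorem IsStrictlyConvexDomain.continuous_sSup_inner (hD : IsStrictlyConvexDomain D) :
    Continuous fun l : Plane => sSup ((fun x : Plane => (inner ℝ l x : ℝ)) '' D) := by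
  obtain ⟨R, hR⟩ := hD.isBounded.exists_norm_le
  have hR0 : 0 ≤ R := (norm_nonneg _).trans (hR _ hD.nonempty.some_mem)
  refine (LipschitzWith.of_le_add_mul ⟨R, hR0⟩ fun l l' => ?_).continuous
  refine csSup_le (hD.nonempty.image _) ?_
  rintro _ ⟨x, hx, rfl⟩
  have h1 := le_csSup (hD.isBounded_image_inner l').bddAbove ⟨x, hx, rfl⟩
  have h2 := (abs_le.1 (abs_real_inner_le_norm (l - l') x)).2
  rw [inner_sub_left] at h2
  have h3 := mul_le_mul_of_nonneg_left (hR x hx) (norm_nonneg (l - l'))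
  simp only [dist_eq_norm] at h1 ⊢
  change _ ≤ _ + R * _
  linarith

theorem width_eq_add (D : Set Plane) (l : Plane) :
    width D l = sSup ((fun x : Plane => (inner ℝ l x : ℝ)) '' D)
      + sSup ((fun x : Plane => (inner ℝ (-l) x : ℝ)) '' D) := by
  have : (fun x : Plane => (inner ℝ (-l) x : ℝ)) '' D
      = -((fun x : Plane => (inner ℝ l x : ℝ)) '' D) := by
    rw [← image_neg_eq_neg, image_image]
    simp
  rw [width, this, Real.sInf_def]
  ring

theorem width_neg (D : Set Plane) (l : Plane) : width D (-l) = width D l := by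
  rw [width_eq_add, width_eq_add, neg_neg, add_comm]

theorem IsStrictlyConvexDomain.continuous_width (hD : IsStrictlyConvexDomain D) :
    Continuous (width D) := by
  rw [funext (width_eq_add D)]
  exact hD.continuous_sSup_inner.add (hD.continuous_sSup_inner.comp continuous_neg)

end

/-! ### Non-scattering plane waves and the width -/

theorem IsNonScattering.integral_eq_zero {D : Set Plane} (hD : IsStrictlyConvexDomain D)
    {a q n k : ℝ} (hq : q = a * n ^ 2) (hn : 1 < n) (hna : 1 < n * a) (hk : 0 < k)
    {η : Plane} (hη : ‖η‖ = 1) (h : IsNonScattering D a q k (planeWave k η))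
    {ξ : Plane} (hξ : ‖ξ‖ = 1) :
    ∫ x in D, planeWave k η x * planeWave (k * n) ξ x = 0 := by
  have h1 := h.mul_integral_eq_zero hD.isOpen hD.isBounded hD.convex hq hη hξ
  refine (mul_eq_zero.1 h1).resolve_left ?_
  rw [Complex.ofReal_eq_zero]
  have hc := abs_le.1 (abs_real_inner_le_norm η ξ)
  rw [hη, hξ, mul_one] at hc
  set c : ℝ := inner ℝ η ξ
  -- Divided by `-k²`, the factor is affine in `c ∈ [-1, 1]`; the products in `e1` and `e2` are its
  -- values at `c = -1` and `c = 1`.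
  have e1 : 0 < (n * a + 1) * (n - 1) := mul_pos (by linarith) (by linarith)
  have e2 : 0 < (n * a - 1) * (n + 1) := mul_pos (by linarith) (by linarith)
  have e3 : 0 < a * n ^ 2 - 1 - (1 - a) * n * c := by
    rcases lt_or_ge c 1 with h1 | h1
    · nlinarith [mul_pos e1 (sub_pos.2 h1), mul_nonneg e2.le (by linarith : 0 ≤ 1 + c)]
    · rw [le_antisymm hc.2 h1]
      linarith
  have e4 := mul_pos (pow_pos hk 2) e3
  rw [hq]
  intro h0
  linarith

/-- The distance from the origin, in the direction `l`, of the circle with centre `k η` and radius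
`k n`. -/
noncomputable def circleRadius (k n : ℝ) (η l : Plane) : ℝ :=
  k * (inner ℝ η l + Real.sqrt ((inner ℝ η l) ^ 2 + (n ^ 2 - 1)))

theorem continuous_circleRadius (k n : ℝ) (η : Plane) : Continuous (circleRadius k n η) := by
  have : Continuous fun l : Plane => (inner ℝ η l : ℝ) := (innerSL ℝ η).continuous
  unfold circleRadius
  fun_prop

section
variable {k n : ℝ} {η l : Plane}

theorem circleRadius_sq (hn : 1 < n) :
    circleRadius k n η l ^ 2 - 2 * k * inner ℝ η l * circleRadius k n η l
      = k ^ 2 * (n ^ 2 - 1) := by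
  have h := Real.sq_sqrt (by nlinarith [sq_nonneg (inner ℝ η l : ℝ)] :
    0 ≤ (inner ℝ η l : ℝ) ^ 2 + (n ^ 2 - 1))
  unfold circleRadius
  linear_combination k ^ 2 * h

/-- Up to sign, the power of the origin with respect to the circle. It is the same for all `l`,
which removes `η` from the comparison of widths. -/
theorem circleRadius_mul_neg (hn : 1 < n) :
    circleRadius k n η l * circleRadius k n η (-l) = k ^ 2 * (n ^ 2 - 1) := by
  have h := Real.sq_sqrt (by nlinarith [sq_nonneg (inner ℝ η l : ℝ)] :
    0 ≤ (inner ℝ η l : ℝ) ^ 2 + (n ^ 2 - 1))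
  simp only [circleRadius, inner_neg_right, neg_sq]
  linear_combination k ^ 2 * h

theorem circleRadius_pos (hn : 1 < n) (hk : 0 < k) : 0 < circleRadius k n η l := by
  refine mul_pos hk ?_
  have : |(inner ℝ η l : ℝ)| < Real.sqrt ((inner ℝ η l) ^ 2 + (n ^ 2 - 1)) :=
    Real.lt_sqrt_of_sq_lt (by rw [sq_abs]; nlinarith)
  linarith [neg_abs_le (inner ℝ η l : ℝ)]

theorem circleRadius_self (hn : 1 < n) (hη : ‖η‖ = 1) : circleRadius k n η η = k * (n + 1) := by
  simp only [circleRadius, real_inner_self_eq_norm_sq, hη]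
  rw [show ((1 : ℝ) ^ 2) ^ 2 + (n ^ 2 - 1) = n ^ 2 by ring, Real.sqrt_sq (by linarith)]
  ring

theorem circleRadius_neg_self (hn : 1 < n) (hη : ‖η‖ = 1) :
    circleRadius k n η (-η) = k * (n - 1) := by
  simp only [circleRadius, inner_neg_right, real_inner_self_eq_norm_sq, hη]
  rw [show (-(1 : ℝ) ^ 2) ^ 2 + (n ^ 2 - 1) = n ^ 2 by ring, Real.sqrt_sq (by linarith)]
  ring

/-- The point `t • l` lies on the circle, so `t • l - k • η` is `k * n` times a unit vector `ξ`, and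
the product of the two plane waves is the plane wave with frequency vector `t • l`. -/
theorem integral_planeWave_circleRadius_eq_zero {D : Set Plane} (hn : 1 < n) (hk : 0 < k)
    (hη : ‖η‖ = 1) (hl : ‖l‖ = 1)
    (h : ∀ ξ : Plane, ‖ξ‖ = 1 → ∫ x in D, planeWave k η x * planeWave (k * n) ξ x = 0) :
    ∫ x in D, planeWave (circleRadius k n η l) l x = 0 := by
  have hkn : 0 < k * n := mul_pos hk (by linarith)
  set t := circleRadius k n η l with ht
  have hnorm : ‖t • l - k • η‖ = k * n := by
    have h1 : ‖t • l - k • η‖ ^ 2 = (k * n) ^ 2 := by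
      rw [norm_sub_sq_real, norm_smul, norm_smul, inner_smul_left, inner_smul_right, hl, hη,
        real_inner_comm, mul_one, mul_one, Real.norm_eq_abs, Real.norm_eq_abs, sq_abs, sq_abs]
      simp only [conj_trivial]
      linear_combination circleRadius_sq (k := k) (η := η) (l := l) hn
    rwa [sq_eq_sq₀ (norm_nonneg _) hkn.le] at h1
  rw [← h ((k * n)⁻¹ • (t • l - k • η)) (by
    rw [norm_smul, hnorm, Real.norm_of_nonneg (inv_nonneg.2 hkn.le), inv_mul_cancel₀ hkn.ne'])]
  refine integral_congr_ae (.of_forall fun x => ?_)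
  simp only [planeWave]
  rw [← Complex.exp_add, ← mul_add, ← Complex.ofReal_add, inner_smul_left, conj_trivial,
    mul_inv_cancel_left₀ hkn.ne', inner_sub_left, inner_smul_left, inner_smul_left,
    conj_trivial, conj_trivial, add_sub_cancel]

end

/-- A continuous function on a connected set that avoids the positive multiples of `P` stays
between two consecutive ones. -/
theorem IsPreconnected.exists_forall_mem_Ioo {X : Type*} [TopologicalSpace X] {s : Set X}
    (hs : IsPreconnected s) {x₀ : X} (hx₀ : x₀ ∈ s) {F : X → ℝ} (hF : ContinuousOn F s) {P : ℝ}
    (hP : 0 < P) (hle : ∀ x ∈ s, P ≤ F x) (hne : ∀ x ∈ s, ∀ m : ℕ, 0 < m → F x ≠ P * m) :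
    ∃ m : ℕ, 0 < m ∧ ∀ x ∈ s, P * m < F x ∧ F x < P * (m + 1) := by
  -- The lower bound `P ≤ F` makes the integer part at `x₀` at least `1`, so both neighbouring
  -- multiples are among the avoided ones.
  have h1 : 1 ≤ F x₀ / P := (one_le_div hP).2 (hle x₀ hx₀)
  have hm : 0 < ⌊F x₀ / P⌋₊ := Nat.floor_pos.2 h1
  refine ⟨⌊F x₀ / P⌋₊, hm, fun x hx => ?_⟩
  have h2 := (le_div_iff₀' hP).1 (Nat.floor_le (zero_le_one.trans h1))
  have h3 := (div_lt_iff₀' hP).1 (Nat.lt_floor_add_one (F x₀ / P))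
  constructor
  · by_contra! h
    obtain ⟨y, hy, hyF⟩ := hs.intermediate_value hx hx₀ hF ⟨h, h2⟩
    exact hne y hy _ hm hyF
  · by_contra! h
    obtain ⟨y, hy, hyF⟩ := hs.intermediate_value hx₀ hx hF ⟨h3.le, h⟩
    exact hne y hy (_ + 1) (Nat.succ_pos _) (by rw [hyF]; push_cast; rfl)

/-- If a plane wave is non-scattering, then the optical widths of the domain along the frequency
circle lie strictly between two consecutive multiples of `2π`. -/
theorem IsNonScattering.exists_forall_circleRadius_mul_width {D : Set Plane}
    (hD : IsStrictlyConvexDomain D) {a q n k : ℝ} (hq : q = a * n ^ 2) (hn : 1 < n)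
    (hna : 1 < n * a) (hk : 0 < k) {η : Plane} (hη : ‖η‖ = 1)
    (h : IsNonScattering D a q k (planeWave k η)) :
    ∃ m : ℕ, 0 < m ∧ ∀ l : Plane, ‖l‖ = 1 →
      2 * Real.pi * m < circleRadius k n η l * width D l ∧
      circleRadius k n η l * width D l < 2 * Real.pi * (m + 1) := by
  have hz : ∀ l : Plane, ‖l‖ = 1 → ∫ x in D, planeWave (circleRadius k n η l) l x = 0 :=
    fun l hl => integral_planeWave_circleRadius_eq_zero hn hk hη hl fun ξ hξ =>
      h.integral_eq_zero hD hq hn hna hk hη hξ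
  have hs : IsPreconnected (Metric.sphere (0 : Plane) 1) := by
    refine isPreconnected_sphere ?_ 0 1
    rw [rank_eq_card_basis (EuclideanSpace.basisFun (Fin 2) ℝ).toBasis]
    simp
  obtain ⟨m, hm, hmF⟩ := hs.exists_forall_mem_Ioo (x₀ := η) (by simpa using hη)
    ((continuous_circleRadius k n η).mul hD.continuous_width).continuousOn Real.two_pi_pos
    (fun l hl => hD.two_pi_le_mul_width (by simpa using hl) (circleRadius_pos hn hk)
      (hz l (by simpa using hl)))
    (fun l hl m hm => hD.mul_width_ne (by simpa using hl) (hz l (by simpa using hl)) hm)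
  exact ⟨m, hm, fun l hl => hmF l (by simpa using hl)⟩

theorem mainTheorem5 (D : Set Plane) (hD : IsStrictlyConvexDomain D)
    (a q : ℝ) (ha : 0 < a) (hq : 0 < q)
    (hn : 1 < refractiveIndex a q) (hna : 1 < refractiveIndex a q * a) :
    (HasConstantWidth D → refractiveIndex a q ≤ 3 →
      ∀ k : ℝ, 0 < k → ∀ η : Plane, ‖η‖ = 1 → IsScattered D a q k (planeWave k η)) ∧
    (2 * minWidth D ≤ maxWidth D →
      ∀ k : ℝ, 0 < k → ∀ η : Plane, ‖η‖ = 1 → IsScattered D a q k (planeWave k η)) := by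
  have hqn : q = a * refractiveIndex a q ^ 2 := by
    rw [refractiveIndex, Real.sq_sqrt (div_pos hq ha).le, mul_div_cancel₀ _ ha.ne']
  set n := refractiveIndex a q
  have hπ := Real.pi_pos
  constructor
  · rintro ⟨c, hc⟩ hn3 k hk η hη h
    obtain ⟨m, hm, hmF⟩ := h.exists_forall_circleRadius_mul_width hD hqn hn hna hk hη
    have hm1 : (1 : ℝ) ≤ m := by exact_mod_cast hm
    have h1 := (hmF η hη).2
    have h2 := (hmF (-η) (by rwa [norm_neg])).1
    rw [circleRadius_self hn hη, hc η hη] at h1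
    rw [circleRadius_neg_self hn hη, hc _ (by rwa [norm_neg])] at h2
    have hkc : 0 < k * c := by
      have : 0 < 2 * Real.pi * m := by positivity
      nlinarith
    -- The chain is `k (n + 1) c < 2π (m + 1) ≤ 4π m < 2 k (n - 1) c`, whereas `n ≤ 3` gives `2 (n -
    -- 1) ≤ n + 1`.
    nlinarith [mul_nonneg hkc.le (sub_nonneg.2 hn3), mul_le_mul_of_nonneg_left hm1 hπ.le]
  · intro hw k hk η hη h
    obtain ⟨m, hm, hmF⟩ := h.exists_forall_circleRadius_mul_width hD hqn hn hna hk hη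
    have hm1 : (1 : ℝ) ≤ m := by exact_mod_cast hm
    have hm0 : 0 < 2 * Real.pi * m := by positivity
    have hne : (Metric.sphere (0 : Plane) 1).Nonempty := ⟨η, by simpa using hη⟩
    have hcpt : IsCompact (width D '' Metric.sphere 0 1) :=
      (isCompact_sphere 0 1).image hD.continuous_width
    obtain ⟨l, hl, hlw⟩ := hcpt.sSup_mem (hne.image _)
    obtain ⟨l', hl', hlw'⟩ := hcpt.sInf_mem (hne.image _)
    rw [mem_sphere_zero_iff_norm] at hl hl'
    rw [minWidth, maxWidth, ← hlw, ← hlw'] at hw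
    -- The bounds at `l` and `-l` are multiplied; the width is even and the product of the radii is
    -- constant.
    have hprod : ∀ l : Plane, ‖l‖ = 1 →
        (2 * Real.pi * m) ^ 2 < k ^ 2 * (n ^ 2 - 1) * width D l ^ 2 ∧
        k ^ 2 * (n ^ 2 - 1) * width D l ^ 2 < (2 * Real.pi * (m + 1)) ^ 2 := by
      intro l hl
      have h1 := hmF l hl
      have h2 := hmF (-l) (by rwa [norm_neg])
      rw [width_neg] at h2
      rw [← circleRadius_mul_neg (k := k) (η := η) (l := l) hn,
        show circleRadius k n η l * circleRadius k n η (-l) * width D l ^ 2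
          = (circleRadius k n η l * width D l) * (circleRadius k n η (-l) * width D l) by ring,
        sq, sq]
      exact ⟨mul_lt_mul'' h1.1 h2.1 hm0.le hm0.le,
        mul_lt_mul'' h1.2 h2.2 (hm0.trans h1.1).le (hm0.trans h2.1).le⟩
    have hw0 : 0 ≤ width D l' :=
      (pos_of_mul_pos_right (hm0.trans (hmF l' hl').1) (circleRadius_pos hn hk).le).le
    have hκ : 0 ≤ k ^ 2 * (n ^ 2 - 1) := mul_nonneg (sq_nonneg k) (by nlinarith)
    have h1 := (hprod l hl).2
    have h2 := (hprod l' hl').1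
    have h3 : (2 * width D l') ^ 2 ≤ width D l ^ 2 := pow_le_pow_left₀ (by linarith) hw 2
    have h4 := mul_le_mul_of_nonneg_left h3 hκ
    -- This is `m + 1 ≤ 2 m`, the reason why `m ≥ 1` matters and why the threshold for the width
    -- ratio is `2`.
    have h5 : (2 * Real.pi * (m + 1)) ^ 2 ≤ (2 * (2 * Real.pi * m)) ^ 2 :=
      pow_le_pow_left₀ (by positivity) (by nlinarith) 2
    nlinarith
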